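/- A simple graph (finite or infinite) is called planar if it can be drawn in the Euclidean plane $\mathbb{R}^2$ so that its edges do not cross: distinct vertices are represented by distinct points, each edge by a simple arc (an injective continuous image of $[0,1]$) joining the points of its two end vertices, no arc contains a vertex point in its interior, and the interiors of the arcs of two different edges are disjoint. A graph is complete if any two distinct vertices are adjacent. Theorem C3. Let $G$ be a simple graph. There is no subgraph $H$ of $G$ with $h>4$ vertices that is both complete and planar. Equivalently, no complete graph with $h>4$ vertices is planar; in particular, $K_5$ cannot be drawn in the plane without crossings. -/

import Mathlib

namespace SimpleGraph

/-- A drawing of the graph `G` in the Euclidean plane without crossings: distinct vertices are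
distinct points, every edge is a simple arc (an injective continuous curve) joining its two
end points, no edge runs through a vertex in its interior, and the interiors of two different
edges have no point in common. The direction in which an edge is traversed is irrelevant. -/
structure PlaneDrawing {V : Type*} (G : SimpleGraph V) where
  /-- the point at which a vertex is placed -/
  point : V → EuclideanSpace ℝ (Fin 2)
  /-- the curve along which an edge is drawn -/
  arc : G.edgeSet → C(unitInterval, EuclideanSpace ℝ (Fin 2))
  point_injective : Function.Injective point
  arc_injective : ∀ e, Function.Injective (arc e)
  arc_ends : ∀ e : G.edgeSet, s(arc e 0, arc e 1) = Sym2.map point (e : Sym2 V)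
  arc_ne_point : ∀ (e : G.edgeSet) (t : unitInterval), 0 < t → t < 1 → ∀ v : V, arc e t ≠ point v
  arc_ne_arc : ∀ e f : G.edgeSet, e ≠ f → ∀ s t : unitInterval,
    0 < s → s < 1 → 0 < t → t < 1 → arc e s ≠ arc f t

/-- A graph is planar if it can be drawn in the plane so that its edges do not cross. -/
def IsPlanar {V : Type*} (G : SimpleGraph V) : Prop :=
  Nonempty G.PlaneDrawing

end SimpleGraph

open Complex unitInterval

/-! Identify the plane with `ℂ`. For disjoint arcs `γ`, `δ`, the function `γ s - δ t` has a
continuous logarithm on the square, so its increment around the boundary vanishes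
(`logVariation_boundary_eq_zero`). On each side one arc winds about an end point of the other; this
increment is known from the five points up to a multiple of `2πi`. The vanishing thus becomes an
integer identity for each of the 15 pairs of independent edges of `K₅`, and these identities are
incompatible modulo 2 (`false_of_crossing_parity`). -/

instance unitInterval.instContractibleSpace : ContractibleSpace I :=
  (convex_Icc (0 : ℝ) 1).contractibleSpace ⟨0, by simp⟩

instance unitInterval.instLocallyPathConnectedSpace : LocallyPathConnectedSpace I :=
  (isQuotientMap_projIcc (h := zero_le_one)).locallyPathConnectedSpace

lemma unitInterval.eq_zero_or_one_or_interior (t : I) : (t = 0 ∨ t = 1) ∨ 0 < t ∧ t < 1 := by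
  rcases eq_or_ne t 0 with h | h
  · exact .inl (.inl h)
  rcases eq_or_ne t 1 with h' | h'
  · exact .inl (.inr h')
  exact .inr ⟨unitInterval.pos_iff_ne_zero.2 h, unitInterval.lt_one_iff_ne_one.2 h'⟩

lemma Complex.exists_continuousMap_log {A : Type*} [TopologicalSpace A] [SimplyConnectedSpace A]
    [LocallyPathConnectedSpace A] (f : C(A, ℂ)) (hf : ∀ a, f a ≠ 0) :
    ∃ F : C(A, ℂ), ∀ a, exp (F a) = f a := by
  obtain ⟨a₀⟩ : Nonempty A := inferInstance
  obtain ⟨F, ⟨-, hF⟩, -⟩ := isCoveringMapOn_exp.existsUnique_continuousMap_lifts f (a₀ := a₀)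
    (e₀ := log (f a₀)) (exp_log (hf a₀)) (fun a => by simpa using hf a)
  exact ⟨F, congrFun hF⟩

/-- By uniqueness of lifts through `exp`, the two logarithms differ by a constant. -/
lemma Complex.increment_eq_of_exp_eq_mul_exp {L L' : C(I, ℂ)} {κ : ℂ}
    (h : ∀ t, exp (L t) = κ * exp (L' t)) : L 1 - L 0 = L' 1 - L' 0 := by
  let M : C(I, ℂ) := L' + .const I (L 0 - L' 0)
  have hM (t : I) : M t = L' t + (L 0 - L' 0) := rfl
  have hexp (t : I) : exp (M t) = exp (L t) := by
    rw [hM, exp_add, exp_sub, h t, h 0]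
    field_simp [exp_ne_zero]
  have huniq := isCoveringMapOn_exp.existsUnique_continuousMap_lifts
    (⟨fun t => exp (L t), by fun_prop⟩ : C(I, ℂ)) (a₀ := 0) (e₀ := L 0) rfl
    (fun t => by simp)
  have heq : L = M := huniq.unique ⟨rfl, rfl⟩ ⟨by rw [hM]; ring, funext hexp⟩
  have h1 : L 1 = M 1 := by rw [← heq]
  rw [h1, hM]
  ring

open Classical in
/-- The change of a continuous branch of `log (γ t - c)` along a path `γ` that avoids the point `c`
(and zero if there is no such branch). -/
noncomputable def logVariation (γ : C(I, ℂ)) (c : ℂ) : ℂ :=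
  if h : ∃ F : C(I, ℂ), ∀ t, exp (F t) = γ t - c then h.choose 1 - h.choose 0 else 0

lemma logVariation_eq_increment {γ L : C(I, ℂ)} {c κ : ℂ} (hγ : ∀ t, γ t ≠ c)
    (hL : ∀ t, exp (L t) = κ * (γ t - c)) : logVariation γ c = L 1 - L 0 := by
  have h : ∃ F : C(I, ℂ), ∀ t, exp (F t) = γ t - c :=
    exists_continuousMap_log (γ - .const I c) fun t => sub_ne_zero.2 (hγ t)
  rw [logVariation, dif_pos h]
  exact (increment_eq_of_exp_eq_mul_exp fun t => by rw [hL, h.choose_spec]).symm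

lemma exists_int_logVariation_eq {γ : C(I, ℂ)} {c x y : ℂ} (hγ : ∀ t, γ t ≠ c)
    (hx : exp x = γ 0 - c) (hy : exp y = γ 1 - c) :
    ∃ n : ℤ, logVariation γ c = y - x + n * (2 * Real.pi * Complex.I) := by
  obtain ⟨F, hF⟩ := exists_continuousMap_log (γ - .const _ c) fun t => sub_ne_zero.2 (hγ t)
  have hF' (t) : exp (F t) = γ t - c := hF t
  obtain ⟨m, hm⟩ := exp_eq_exp_iff_exists_int.1 ((hF' 0).trans hx.symm)
  obtain ⟨n, hn⟩ := exp_eq_exp_iff_exists_int.1 ((hF' 1).trans hy.symm)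
  refine ⟨n - m, ?_⟩
  rw [logVariation_eq_increment (κ := 1) hγ (fun t => by rw [hF', one_mul]), hm, hn]
  push_cast
  ring

/-- Going around the boundary of the square of pairs of points on two disjoint paths, the logarithm
of their difference does not change. -/
lemma logVariation_boundary_eq_zero {γ δ : C(I, ℂ)} (h : ∀ s t, γ s ≠ δ t) :
    logVariation γ (δ 0) - logVariation γ (δ 1) + logVariation δ (γ 1) - logVariation δ (γ 0)
      = 0 := by
  obtain ⟨F, hF⟩ := exists_continuousMap_log (A := I × I) ⟨fun p => γ p.1 - δ p.2, by fun_prop⟩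
    fun p => sub_ne_zero.2 (h p.1 p.2)
  have hF' (s t : I) : exp (F (s, t)) = γ s - δ t := hF (s, t)
  have hfst (t : I) : logVariation γ (δ t) = F (1, t) - F (0, t) :=
    logVariation_eq_increment (L := ⟨fun s => F (s, t), by fun_prop⟩) (κ := 1) (fun s => h s t)
      fun s => by simpa using hF' s t
  have hsnd (s : I) : logVariation δ (γ s) = F (s, 1) - F (s, 0) :=
    -- Here `F` is a logarithm of `γ s - δ t`, the negative of `δ t - γ s`.
    logVariation_eq_increment (L := ⟨fun t => F (s, t), by fun_prop⟩) (κ := -1)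
      (fun t => (h s t).symm) fun t => by simpa using hF' s t
  rw [hfst, hfst, hsnd, hsnd]
  ring

/-- The parity identity behind the non-planarity of `K₅`: the crossings of the ten chords between
five points on a line, compared with the windings of the edges around the other points. -/
lemma false_of_crossing_parity (n : Fin 5 → Fin 5 → Fin 5 → ℤ)
    (h : ∀ a b c d : Fin 5, a < b → c < d → a ≠ c → a ≠ d → b ≠ c → b ≠ d →
      (if c < b then -1 else 1 : ℤ) - (if c < a then -1 else 1) - (if d < b then -1 else 1)
        + (if d < a then -1 else 1) = 2 * (n c a b - n d a b + n b c d - n a c d)) : False := by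
  -- All 15 pairs of disjoint chords. After halving, the left side is odd exactly for interleaved
  -- chords, one pair for each four points, hence five in all. Each `n c a b` occurs in two
  -- identities, one for each remaining `d`, so modulo 2 the right sides sum to 0.
  have h₁ := h 0 1 2 3
  have h₂ := h 0 1 2 4
  have h₃ := h 0 1 3 4
  have h₄ := h 0 2 1 3
  have h₅ := h 0 2 1 4
  have h₆ := h 0 2 3 4
  have h₇ := h 0 3 1 2
  have h₈ := h 0 3 1 4
  have h₉ := h 0 3 2 4
  have h₁₀ := h 0 4 1 2
  have h₁₁ := h 0 4 1 3
  have h₁₂ := h 0 4 2 3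
  have h₁₃ := h 1 2 3 4
  have h₁₄ := h 1 3 2 4
  have h₁₅ := h 1 4 2 3
  simp +decide only [forall_const, if_true, if_false] at *
  omega

/-- Among the curves joining five points in the plane, some two without a common end point meet. -/
lemma false_of_disjoint_paths {P : Fin 5 → ℂ} (γ : Fin 5 → Fin 5 → C(I, ℂ))
    (hP : Function.Injective P)
    (h0 : ∀ a b, a < b → γ a b 0 = P a) (h1 : ∀ a b, a < b → γ a b 1 = P b)
    (hne : ∀ a b c, a < b → a ≠ c → b ≠ c → ∀ t, γ a b t ≠ P c)
    (hdisj : ∀ a b c d, a < b → c < d → a ≠ c → a ≠ d → b ≠ c → b ≠ d →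
      ∀ s t, γ a b s ≠ γ c d t) : False := by
  -- Both orders use the same value of `log`, so that swapping `u` and `v` changes `φ` by exactly
  -- `±πi`, with the sign fixed by the order.
  let φ (u v : Fin 5) : ℂ := if u < v then log (P v - P u) else log (P u - P v) + Real.pi * Complex.I
  have hφ {u v : Fin 5} (huv : u ≠ v) : exp (φ u v) = P v - P u := by
    by_cases hlt : u < v
    · simp only [φ, if_pos hlt]
      exact exp_log (sub_ne_zero.2 (hP.ne huv.symm))
    · simp only [φ, if_neg hlt]
      rw [exp_add, exp_pi_mul_I, exp_log (sub_ne_zero.2 (hP.ne huv))]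
      ring
  have hφ_swap {u v : Fin 5} (huv : u ≠ v) :
      φ u v - φ v u = (if u < v then -1 else 1 : ℤ) * (Real.pi * Complex.I) := by
    rcases huv.lt_or_gt with hlt | hlt
    · simp [φ, hlt, hlt.not_gt]
    · simp [φ, hlt, hlt.not_gt]
  have hn (c a b : Fin 5) : ∃ n : ℤ, a < b → a ≠ c → b ≠ c →
      logVariation (γ a b) (P c) = φ c b - φ c a + n * (2 * Real.pi * Complex.I) := by
    by_cases hc : a < b ∧ a ≠ c ∧ b ≠ c
    · obtain ⟨hab, hac, hbc⟩ := hc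
      obtain ⟨n, hn⟩ := exists_int_logVariation_eq (hne a b c hab hac hbc) (x := φ c a)
        (y := φ c b) (by rw [hφ hac.symm, h0 a b hab]) (by rw [hφ hbc.symm, h1 a b hab])
      exact ⟨n, fun _ _ _ => hn⟩
    · exact ⟨0, fun h₁ h₂ h₃ => absurd ⟨h₁, h₂, h₃⟩ hc⟩
  choose n hn using hn
  refine false_of_crossing_parity (fun c a b => -n c a b) fun a b c d hab hcd hac had hbc hbd => ?_
  have hsq := logVariation_boundary_eq_zero (hdisj a b c d hab hcd hac had hbc hbd)
  rw [h0 a b hab, h1 a b hab, h0 c d hcd, h1 c d hcd, hn c a b hab hac hbc, hn d a b hab had hbd,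
    hn b c d hcd hbc.symm hbd.symm, hn a c d hcd hac.symm had.symm] at hsq
  have hcb := hφ_swap hbc.symm
  have hca := hφ_swap hac.symm
  have hdb := hφ_swap hbd.symm
  have hda := hφ_swap had.symm
  have hpi : (Real.pi * Complex.I : ℂ) ≠ 0 := mul_ne_zero (by exact_mod_cast Real.pi_ne_zero) Complex.I_ne_zero
  have hint : (((if c < b then -1 else 1 : ℤ) - (if c < a then -1 else 1)
      - (if d < b then -1 else 1) + (if d < a then -1 else 1) : ℤ) : ℂ)
      = ((2 * (-n c a b - -n d a b + -n b c d - -n a c d) : ℤ) : ℂ) := by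
    apply mul_right_cancel₀ hpi
    -- Keeps the signs atomic, so that `push_cast` does not move casts into the conditionals.
    generalize (if c < b then -1 else 1 : ℤ) = e₁ at *
    generalize (if c < a then -1 else 1 : ℤ) = e₂ at *
    generalize (if d < b then -1 else 1 : ℤ) = e₃ at *
    generalize (if d < a then -1 else 1 : ℤ) = e₄ at *
    push_cast
    linear_combination hsq - hcb + hca + hdb - hda
  exact_mod_cast hint

namespace SimpleGraph

namespace PlaneDrawing

variable {V : Type*} {G : SimpleGraph V}

lemma arc_zero_or_one (D : G.PlaneDrawing) (e : G.edgeSet) {t : I}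
    (ht : t = 0 ∨ t = 1) :
    ∃ v ∈ (e : Sym2 V), D.arc e t = D.point v := by
  have hmem : D.arc e t ∈ Sym2.map D.point (e : Sym2 V) := by
    rw [← D.arc_ends e]
    rcases ht with rfl | rfl <;> simp
  obtain ⟨v, hv, h⟩ := Sym2.mem_map.1 hmem
  exact ⟨v, hv, h.symm⟩

lemma arc_ne_point_of_notMem (D : G.PlaneDrawing) {e : G.edgeSet} {v : V}
    (hv : v ∉ (e : Sym2 V)) (t : I) :
    D.arc e t ≠ D.point v := by
  rcases eq_zero_or_one_or_interior t with ht | ⟨h₀, h₁⟩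
  · obtain ⟨w, hw, h⟩ := D.arc_zero_or_one e ht
    rw [h]
    exact D.point_injective.ne fun hwv => hv (hwv ▸ hw)
  · exact D.arc_ne_point e t h₀ h₁ v

lemma arc_ne_arc_of_disjoint (D : G.PlaneDrawing) {e f : G.edgeSet}
    (hef : ∀ v ∈ (e : Sym2 V), v ∉ (f : Sym2 V))
    (s t : I) : D.arc e s ≠ D.arc f t := by
  rcases eq_zero_or_one_or_interior s with hs | ⟨hs₀, hs₁⟩
  · obtain ⟨v, hv, h⟩ := D.arc_zero_or_one e hs
    rw [h]
    exact (D.arc_ne_point_of_notMem (hef v hv) t).symm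
  rcases eq_zero_or_one_or_interior t with ht | ⟨ht₀, ht₁⟩
  · obtain ⟨v, hv, h⟩ := D.arc_zero_or_one f ht
    rw [h]
    exact D.arc_ne_point_of_notMem (fun hve => hef v hve hv) s
  · refine D.arc_ne_arc e f ?_ s t hs₀ hs₁ ht₀ ht₁
    rintro rfl
    exact hef _ (Sym2.out_fst_mem (e : Sym2 V)) (Sym2.out_fst_mem (e : Sym2 V))

lemma exists_path (D : G.PlaneDrawing) {a b : V} (h : G.Adj a b) :
    ∃ γ : C(I, EuclideanSpace ℝ (Fin 2)), γ 0 = D.point a ∧ γ 1 = D.point b ∧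
      ∀ t, ∃ s, γ t = D.arc ⟨s(a, b), h⟩ s := by
  have hends := D.arc_ends ⟨s(a, b), h⟩
  rw [Sym2.map_mk, Sym2.eq_iff] at hends
  rcases hends with ⟨h₀, h₁⟩ | ⟨h₀, h₁⟩
  · exact ⟨D.arc _, h₀, h₁, fun t => ⟨t, rfl⟩⟩
  · refine ⟨(D.arc ⟨s(a, b), h⟩).comp ⟨σ, by fun_prop⟩, ?_, ?_, fun t => ⟨σ t, rfl⟩⟩
    · simpa using h₁
    · simpa using h₀

/-- A graph with five pairwise adjacent vertices has no plane drawing. -/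
theorem false_of_pairwise_adj (D : G.PlaneDrawing) {q : Fin 5 → V} (hq : Pairwise fun a b => G.Adj (q a) (q b)) :
    False := by
  have hinj : Function.Injective q := fun a b hab => by
    by_contra hne
    exact (hq hne).ne hab
  let Z := Complex.orthonormalBasisOneI.repr.symm
  have hpath (a b : Fin 5) : ∃ γ : C(I, EuclideanSpace ℝ (Fin 2)), ∀ h : a ≠ b,
      γ 0 = D.point (q a) ∧ γ 1 = D.point (q b) ∧ ∀ t, ∃ s, γ t = D.arc ⟨s(q a, q b), hq h⟩ s := by
    by_cases h : a = b
    -- A dummy path: no edge joins a vertex to itself.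
    · exact ⟨.const _ 0, fun h' => absurd h h'⟩
    · obtain ⟨γ, hγ⟩ := D.exists_path (hq h)
      exact ⟨γ, fun _ => hγ⟩
  choose γ hγ using hpath
  refine false_of_disjoint_paths (P := fun a => Z (D.point (q a)))
    (fun a b => ⟨fun t => Z (γ a b t), by fun_prop⟩)
    (Z.injective.comp (D.point_injective.comp hinj))
    (fun a b hab => congrArg Z (hγ a b hab.ne).1) (fun a b hab => congrArg Z (hγ a b hab.ne).2.1)
    ?_ ?_
  · intro a b c hab hac hbc t
    obtain ⟨s, hs⟩ := (hγ a b hab.ne).2.2 t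
    refine Z.injective.ne ?_
    rw [hs]
    exact D.arc_ne_point_of_notMem (by simp [hinj.eq_iff, hac.symm, hbc.symm]) s
  · intro a b c d hab hcd hac had hbc hbd s t
    obtain ⟨s', hs⟩ := (hγ a b hab.ne).2.2 s
    obtain ⟨t', ht⟩ := (hγ c d hcd.ne).2.2 t
    refine Z.injective.ne ?_
    rw [hs, ht]
    exact D.arc_ne_arc_of_disjoint (by simp [hinj.eq_iff, hac, had, hbc, hbd]) s' t'

end PlaneDrawing

lemma not_isPlanar_completeGraph {V : Type*} (h : 4 < ENat.card V) :
    ¬ (completeGraph V).IsPlanar := by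
  rintro ⟨D⟩
  have hcard : ((5 : ℕ) : ℕ∞) ≤ (Set.univ : Set V).encard := by
    rw [Set.encard_univ]
    exact Order.add_one_le_of_lt h
  obtain ⟨t, -, ht⟩ := Set.exists_subset_encard_eq hcard
  have htf : t.Finite := Set.finite_of_encard_eq_coe ht
  have htc : Nat.card t = 5 := by
    rw [Nat.card_coe_set_eq, Set.ncard, ht]
    rfl
  have : Finite t := htf
  let q : Fin 5 ≃ t := (Finite.equivFinOfCardEq htc).symm
  exact D.false_of_pairwise_adj (q := fun i => (q i : V)) fun a b hab =>
    (top_adj _ _).2 (Subtype.val_injective.comp q.injective |>.ne hab)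

end SimpleGraph

theorem theoremC3 {V : Type*} (G : SimpleGraph V) :
    (¬ ∃ H : G.Subgraph, 4 < H.verts.encard ∧ H.verts.Pairwise H.Adj ∧ H.coe.IsPlanar) ∧
    (4 < ENat.card V → ¬ (SimpleGraph.completeGraph V).IsPlanar) ∧
    ¬ (SimpleGraph.completeGraph (Fin 5)).IsPlanar := by
  refine ⟨?_, SimpleGraph.not_isPlanar_completeGraph,
    SimpleGraph.not_isPlanar_completeGraph (by simp; norm_num)⟩
  rintro ⟨H, hcard, hadj, hplanar⟩
  have hcoe : H.coe = SimpleGraph.completeGraph H.verts := by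
    ext u v
    refine ⟨fun h => h.ne, fun h => hadj u.2 v.2 fun huv => h (Subtype.ext huv)⟩
  exact SimpleGraph.not_isPlanar_completeGraph hcard (hcoe ▸ hplanar)
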